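/- **Theorem.** Define the Euler–Frobenius polynomials by $P_{0,\rho}(x)=1$ and $$P_{n,\rho}(x)=\bigl(nx+\rho(1-x)\bigr)P_{n-1,\rho}(x)+x(1-x)P_{n-1,\rho}'(x),\qquad n\ge 1,$$ and the Euler–Frobenius numbers $A_{n,k,\rho}$ by $P_{n,\rho}(x)=\sum_{k=0}^n A_{n,k,\rho}x^k$. For $0\le\rho<1$ let $\mathcal E_{n,\rho}$ denote a random variable with $\mathbb P(\mathcal E_{n,\rho}=k)=A_{n,k,\rho}/n!$ for $k=0,\dots,n$. For an arbitrary real $\rho$ let $\mathcal E_{n,\rho}=\mathcal E_{n,\{\rho\}}-\lfloor\rho\rfloor$, where $\{\rho\}=\rho-\lfloor\rho\rfloor$. Further, let $U_1,U_2,\dots$ be independent random variables, uniformly distributed on $[0,1]$, and let $Z_{n,\rho}=\lfloor U_1+\dots+U_n+1-\rho\rfloor$. Then, for every fixed real $\rho$, $\mathcal E_{n,\rho}$ is asymptotically normal as $n\to\infty$, i.e. $$\frac{\mathcal E_{n,\rho}-\mathbb E\,\mathcal E_{n,\rho}}{\sqrt{\operatorname{Var}\mathcal E_{n,\rho}}}\xrightarrow{d}N(0,1),$$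 and, more explicitly, $$\frac{\mathcal E_{n,\rho}-n/2}{\sqrt n}\xrightarrow{d}N\Bigl(0,\frac1{12}\Bigr).$$ The same two limits hold with $Z_{n,\rho}$ in place of $\mathcal E_{n,\rho}$. -/

import Mathlib

open MeasureTheory ProbabilityTheory Filter

namespace EulerFrobenius

open Polynomial

noncomputable section

/-- The Euler--Frobenius polynomial `P_{n,ρ}(x)`, through the recursion
`P_{0,ρ} = 1`, `P_{n,ρ} = (n x + ρ (1 - x)) P_{n-1,ρ} + x (1 - x) P_{n-1,ρ}'`. -/
def poly (ρ : ℝ) : ℕ → ℝ[X]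
  | 0 => 1
  | n + 1 => (C ((n : ℝ) + 1) * X + C ρ * (1 - X)) * poly ρ n
      + X * (1 - X) * derivative (poly ρ n)

/-- The Euler--Frobenius number `A_{n,k,ρ}`, the coefficient of `x ^ k` in `P_{n,ρ}(x)`. -/
def number (n k : ℕ) (ρ : ℝ) : ℝ := (poly ρ n).coeff k

/-- For `0 ≤ ρ ≤ 1`: the probability distribution on `{0, …, n} ⊆ ℤ` that gives mass
`A_{n,k,ρ} / n!` to `k`. -/
def unitDist (n : ℕ) (ρ : ℝ) : Measure ℤ :=
  ∑ k ∈ Finset.range (n + 1),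
    ENNReal.ofReal (number n k ρ / (n.factorial : ℝ)) • Measure.dirac (k : ℤ)

/-- The Euler--Frobenius distribution for an arbitrary real parameter `ρ`: the law of
`E - ⌊ρ⌋`, where `E` has the Euler--Frobenius distribution with the parameter `{ρ} ∈ [0, 1)`. -/
def dist (n : ℕ) (ρ : ℝ) : Measure ℤ :=
  (unitDist n (Int.fract ρ)).map (fun k : ℤ => k - ⌊ρ⌋)

/-- `ρ`-rounding of a real number: `⌊x + 1 - ρ⌋`. -/
def rhoRound (ρ x : ℝ) : ℤ := ⌊x + 1 - ρ⌋

theorem poly_natDegree_le (ρ : ℝ) (n : ℕ) : (poly ρ n).natDegree ≤ n := by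
  induction n with
  | zero => simp [poly]
  | succ n ih =>
    have h1 : (C ((n : ℝ) + 1) * X + C ρ * (1 - X) : ℝ[X]).natDegree ≤ 1 := by compute_degree
    have h2 : (1 - X : ℝ[X]).natDegree ≤ 1 := by compute_degree
    have hd := natDegree_derivative_le (poly ρ n)
    rw [poly]
    refine (natDegree_add_le _ _).trans (max_le ?_ ?_)
    · exact (natDegree_mul_le).trans (by omega)
    · rcases Nat.eq_zero_or_pos n with rfl | hn
      · simp [poly]
      · have h3 : (X * (1 - X) : ℝ[X]).natDegree ≤ 2 := by compute_degree
        exact (natDegree_mul_le).trans (by omega)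

theorem number_succ_zero (n : ℕ) (ρ : ℝ) : number (n + 1) 0 ρ = ρ * number n 0 ρ := by
  simp [number, poly, mul_coeff_zero]

theorem number_succ_succ (n k : ℕ) (ρ : ℝ) :
    number (n + 1) (k + 1) ρ
      = (k + 1 + ρ) * number n (k + 1) ρ + (n + 1 - k - ρ) * number n k ρ := by
  have h : poly ρ (n + 1) = C ((n : ℝ) + 1) * (poly ρ n * X) + C ρ * poly ρ n
      - C ρ * (poly ρ n * X) + derivative (poly ρ n) * X - derivative (poly ρ n) * X * X := by
    rw [poly]; ring
  rw [number, h]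
  simp only [coeff_add, coeff_sub, coeff_C_mul, coeff_mul_X, coeff_derivative, number]
  rcases k with _ | k
  · simp; ring
  · simp only [coeff_mul_X, coeff_derivative]; push_cast; ring

theorem number_eq_zero {n k : ℕ} (ρ : ℝ) (h : n < k) : number n k ρ = 0 :=
  coeff_eq_zero_of_natDegree_lt ((poly_natDegree_le ρ n).trans_lt h)

theorem number_nonneg {ρ : ℝ} (h0 : 0 ≤ ρ) (h1 : ρ ≤ 1) (n k : ℕ) : 0 ≤ number n k ρ := by
  induction n generalizing k with
  | zero =>
    rw [number, poly, coeff_one]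
    split_ifs <;> norm_num
  | succ n ih =>
    rcases k with _ | k
    · rw [number_succ_zero]; exact mul_nonneg h0 (ih 0)
    · rw [number_succ_succ]
      refine add_nonneg (mul_nonneg (by positivity) (ih _)) ?_
      rcases le_or_gt k n with hk | hk
      · have : (k : ℝ) ≤ n := by exact_mod_cast hk
        exact mul_nonneg (by linarith) (ih _)
      · simp [number_eq_zero ρ hk]

theorem sum_number (n : ℕ) (ρ : ℝ) :
    ∑ k ∈ Finset.range (n + 1), number n k ρ = n.factorial := by
  have h : ∀ m : ℕ, (poly ρ m).eval 1 = m.factorial := by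
    intro m
    induction m with
    | zero => simp [poly]
    | succ m ih => simp [poly, ih, Nat.factorial_succ]
  rw [← h n, eval_eq_sum_range' (Nat.lt_succ_of_le (poly_natDegree_le ρ n))]
  simp [number]

theorem isProbabilityMeasure_unitDist {ρ : ℝ} (h0 : 0 ≤ ρ) (h1 : ρ ≤ 1) (n : ℕ) :
    IsProbabilityMeasure (unitDist n ρ) := by
  constructor
  have hs : ∑ k ∈ Finset.range (n + 1), number n k ρ / (n.factorial : ℝ) = 1 := by
    rw [← Finset.sum_div, sum_number]
    exact div_self (by positivity)
  simp only [unitDist, Measure.coe_finsetSum, Finset.sum_apply, Measure.smul_apply,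
    measure_univ, smul_eq_mul, mul_one]
  rw [← ENNReal.ofReal_sum_of_nonneg
    (fun k _ => div_nonneg (number_nonneg h0 h1 n k) (by positivity)), hs, ENNReal.ofReal_one]

instance (n : ℕ) (ρ : ℝ) : IsProbabilityMeasure (dist n ρ) := by
  have := isProbabilityMeasure_unitDist (Int.fract_nonneg ρ) (Int.fract_lt_one ρ).le n
  exact Measure.isProbabilityMeasure_map (by fun_prop)

end

end EulerFrobenius

/-! For `n ≥ 1` the Euler–Frobenius law is that of a rounded sum `S_n` of `n` independent uniform
variables (`hasLaw_rhoRound_sum`), so the theorem reduces to the classical central limit theorem.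

The identification runs through cardinal B-splines. Write `T_n = x₊ ^ n / n!` and `∇` for the
backward difference. For `0 ≤ ρ < 1`, both `number n k ρ / n!` and the probability that `S_n` rounds
to `k` equal `∇^(n+1) T_n (k + ρ)`. Algebraically, the Leibniz rule for `x * T_n` reproduces the
recursion of the coefficients. Probabilistically, adding a uniform variable averages the
distribution function over a unit window, turning `∇^n T_n` into `∇^(n+1) T_(n+1)`; the mass of a
unit cell then costs one more difference.

Rounding moves `S_n` by at most `|ρ| + 1`. Divided by `√n` this vanishes, so Slutsky's theorem gives
the explicit limit. The mean stays within `|ρ| + 1` of `n / 2` and the variance is still asymptotic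
to `n / 12`, so a second use of Slutsky gives the standardised limit. -/

namespace EulerFrobenius

open scoped Nat

/-! ### Euler–Frobenius numbers as B-spline values -/

/-- The backward difference operator with step one. -/
def backwardDiff (f : ℝ → ℝ) (x : ℝ) : ℝ := f x - f (x - 1)

/-- The normalised truncated power `x₊ ^ n / n!`, with `0₊ ^ 0 = 1`. -/
noncomputable def truncPow (n : ℕ) (x : ℝ) : ℝ := if 0 ≤ x then x ^ n / n ! else 0

theorem backwardDiff_iterate_succ (f : ℝ → ℝ) (m : ℕ) (x : ℝ) :
    backwardDiff^[m + 1] f x = backwardDiff^[m] f x - backwardDiff^[m] f (x - 1) := by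
  rw [Function.iterate_succ_apply']; rfl

theorem truncPow_of_neg (n : ℕ) {x : ℝ} (hx : x < 0) : truncPow n x = 0 :=
  if_neg hx.not_ge

theorem backwardDiff_iterate_truncPow_of_neg (m n : ℕ) {x : ℝ} (hx : x < 0) :
    backwardDiff^[m] (truncPow n) x = 0 := by
  induction m generalizing x with
  | zero => exact truncPow_of_neg n hx
  | succ m ih => rw [backwardDiff_iterate_succ, ih hx, ih (by linarith), sub_zero]

theorem truncPow_succ (n : ℕ) (x : ℝ) :
    ((n : ℝ) + 1) * truncPow (n + 1) x = x * truncPow n x := by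
  unfold truncPow
  split_ifs
  · rw [Nat.factorial_succ, pow_succ]; push_cast; field_simp
  · simp

/-- Leibniz rule for iterated backward differences of truncated powers. -/
theorem backwardDiff_iterate_truncPow_succ (m n : ℕ) (x : ℝ) :
    ((n : ℝ) + 1) * backwardDiff^[m + 1] (truncPow (n + 1)) x
      = x * backwardDiff^[m + 1] (truncPow n) x
        + ((m : ℝ) + 1) * backwardDiff^[m] (truncPow n) (x - 1) := by
  induction m generalizing x with
  | zero =>
    have h1 := truncPow_succ n x
    have h2 := truncPow_succ n (x - 1)
    simp only [backwardDiff_iterate_succ, Function.iterate_zero, id]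
    push_cast
    linarith
  | succ m ih =>
    have h1 := ih x
    have h2 := ih (x - 1)
    rw [backwardDiff_iterate_succ (truncPow (n + 1)) (m + 1), mul_sub, h1, h2,
      backwardDiff_iterate_succ (truncPow n) (m + 1) x,
      backwardDiff_iterate_succ (truncPow n) m (x - 1)]
    push_cast
    ring

/-- At `x = k + 1 + ρ` the two factors are those of `number_succ_succ`. -/
theorem backwardDiff_truncPow_recursion (n : ℕ) (x : ℝ) :
    ((n : ℝ) + 1) * backwardDiff^[n + 2] (truncPow (n + 1)) x
      = x * backwardDiff^[n + 1] (truncPow n) x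
        + ((n : ℝ) + 2 - x) * backwardDiff^[n + 1] (truncPow n) (x - 1) := by
  rw [backwardDiff_iterate_truncPow_succ, backwardDiff_iterate_succ (truncPow n) (n + 1)]
  push_cast
  ring

/-- Euler--Frobenius numbers are values of cardinal B-splines. -/
theorem number_eq_factorial_mul_backwardDiff {ρ : ℝ} (h0 : 0 ≤ ρ) (h1 : ρ < 1) (n k : ℕ) :
    number n k ρ = n ! * backwardDiff^[n + 1] (truncPow n) (k + ρ) := by
  induction n generalizing k with
  | zero =>
    have hk : (0 : ℝ) ≤ k + ρ := by positivity
    simp only [number, poly, Polynomial.coeff_one, backwardDiff_iterate_succ, Function.iterate_zero,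
      id, truncPow]
    rcases k with _ | k
    · have : ¬ (1 ≤ ρ) := by linarith
      simp [h0, this]
    · push_cast at hk ⊢
      have : (0 : ℝ) ≤ k + 1 + ρ - 1 := by ring_nf; positivity
      simp [hk, this]
  | succ n ih =>
    have hrec := backwardDiff_truncPow_recursion n (k + ρ)
    rw [Nat.factorial_succ, Nat.cast_mul, mul_comm ((n + 1 : ℕ) : ℝ), mul_assoc, Nat.cast_succ,
      hrec]
    rcases k with _ | k
    -- At `k = 0` the second term sits at `ρ - 1 < 0`, where the spline vanishes.
    · rw [number_succ_zero, ih 0,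
        backwardDiff_iterate_truncPow_of_neg (x := ((0 : ℕ) : ℝ) + ρ - 1) _ _ (by simpa using h1)]
      push_cast
      ring
    · rw [number_succ_succ, ih, ih]
      have : ((k + 1 : ℕ) : ℝ) + ρ - 1 = k + ρ := by push_cast; ring
      rw [this]
      push_cast
      ring

/-! ### Unit-window integrals of truncated powers -/

theorem monotone_truncPow (n : ℕ) : Monotone (truncPow n) := by
  intro x y hxy
  unfold truncPow
  split_ifs with hx hy hy
  · gcongr
  · linarith
  · positivity
  · rfl

theorem continuous_truncPow_succ (n : ℕ) : Continuous (truncPow (n + 1)) := by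
  have : truncPow (n + 1) = fun x : ℝ => max x 0 ^ (n + 1) / (n + 1)! := by
    funext x
    unfold truncPow
    split_ifs with hx
    · rw [max_eq_left hx]
    · rw [max_eq_right (by linarith)]; simp
  rw [this]
  fun_prop

theorem hasDerivAt_truncPow_succ (n : ℕ) {x : ℝ} (hx : x ≠ 0) :
    HasDerivAt (truncPow (n + 1)) (truncPow n x) x := by
  rcases lt_or_gt_of_ne hx with hx | hx
  · rw [truncPow_of_neg n hx]
    refine (hasDerivAt_const x (0 : ℝ)).congr_of_eventuallyEq ?_
    filter_upwards [eventually_lt_nhds hx] with y hy using truncPow_of_neg _ hy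
  · have h : HasDerivAt (fun y : ℝ => y ^ (n + 1) / (n + 1)!) (truncPow n x) x := by
      have h := (hasDerivAt_pow (n + 1) x).div_const ((n + 1)! : ℝ)
      have he : ((n + 1 : ℕ) : ℝ) * x ^ (n + 1 - 1) / (n + 1)! = truncPow n x := by
        rw [truncPow, if_pos hx.le, Nat.factorial_succ]
        push_cast
        field_simp
      rwa [he] at h
    refine h.congr_of_eventuallyEq ?_
    filter_upwards [eventually_gt_nhds hx] with y hy using if_pos hy.le

theorem integral_truncPow (n : ℕ) (x : ℝ) :
    ∫ u in (0 : ℝ)..1, truncPow n (x - u) = backwardDiff (truncPow (n + 1)) x := by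
  rw [intervalIntegral.integral_comp_sub_left (truncPow n) x, sub_zero]
  -- The exceptional point is needed for `n = 0`: `x₊` has a corner at `0`.
  exact integral_eq_of_hasDerivAt_off_countable (truncPow (n + 1)) (truncPow n)
    (Set.countable_singleton 0) (continuous_truncPow_succ n).continuousOn
    (fun y hy => hasDerivAt_truncPow_succ n hy.2) (monotone_truncPow n).intervalIntegrable

theorem intervalIntegrable_backwardDiff_iterate {f : ℝ → ℝ}
    (hf : ∀ a b, IntervalIntegrable f volume a b) (m : ℕ) (a b : ℝ) :
    IntervalIntegrable (backwardDiff^[m] f) volume a b := by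
  induction m generalizing a b with
  | zero => exact hf a b
  | succ m ih =>
    have h2 : IntervalIntegrable (fun x => backwardDiff^[m] f (x - 1)) volume a b := by
      simpa using (ih (a - 1) (b - 1)).comp_sub_right 1
    simpa only [funext (backwardDiff_iterate_succ f m)] using! (ih a b).sub h2

theorem integral_backwardDiff_iterate {f : ℝ → ℝ}
    (hf : ∀ a b, IntervalIntegrable f volume a b) (m : ℕ) (x : ℝ) :
    ∫ u in (0 : ℝ)..1, backwardDiff^[m] f (x - u)
      = backwardDiff^[m] (fun y => ∫ u in (0 : ℝ)..1, f (y - u)) x := by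
  induction m generalizing x with
  | zero => rfl
  | succ m ih =>
    have h (y : ℝ) : IntervalIntegrable (fun u => backwardDiff^[m] f (y - u)) volume 0 1 := by
      simpa using (intervalIntegrable_backwardDiff_iterate hf m (y - 0) (y - 1)).comp_sub_left y
    rw [backwardDiff_iterate_succ, ← ih, ← ih, ← intervalIntegral.integral_sub (h x) (h (x - 1))]
    refine intervalIntegral.integral_congr fun u _ => ?_
    simp only [backwardDiff_iterate_succ]
    ring_nf

/-- Integration over a unit window commutes with differences and sends `T_n` to `∇ T_(n+1)`. This is
the induction step for the distribution function of the sum. -/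
theorem integral_backwardDiff_truncPow (n : ℕ) (x : ℝ) :
    ∫ u in (0 : ℝ)..1, backwardDiff^[n] (truncPow n) (x - u)
      = backwardDiff^[n + 1] (truncPow (n + 1)) x := by
  rw [integral_backwardDiff_iterate fun _ _ => (monotone_truncPow n).intervalIntegrable]
  simp only [integral_truncPow]
  rfl

/-! ### Distribution of sums of uniform variables -/

theorem measureReal_uniform_conv_Iic (μ : Measure ℝ) [IsProbabilityMeasure μ] (x : ℝ) :
    ((volume.restrict (Set.Icc (0 : ℝ) 1)).conv μ).real (Set.Iic x)
      = ∫ u in (0 : ℝ)..1, μ.real (Set.Iic (x - u)) := by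
  have hm : Measurable fun u => μ (Set.Iic (x - u)) :=
    (Antitone.measurable fun u v huv =>
      measure_mono (Set.Iic_subset_Iic.2 (by linarith)))
  have h : ((volume.restrict (Set.Icc (0 : ℝ) 1)).conv μ) (Set.Iic x)
      = ∫⁻ u in Set.Icc (0 : ℝ) 1, μ (Set.Iic (x - u)) := by
    rw [← lintegral_indicator_one measurableSet_Iic,
      Measure.lintegral_conv (measurable_one.indicator measurableSet_Iic)]
    refine lintegral_congr fun u => ?_
    rw [← lintegral_indicator_one measurableSet_Iic]
    refine lintegral_congr fun s => ?_
    simp [Set.indicator, le_sub_iff_add_le']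
  rw [measureReal_def, h, intervalIntegral.integral_of_le zero_le_one, ← integral_Icc_eq_integral_Ioc]
  simp only [measureReal_def]
  rw [integral_toReal hm.aemeasurable (ae_of_all _ fun u => measure_lt_top _ _)]

variable {Ω : Type*} [MeasurableSpace Ω] {P : Measure Ω} [IsProbabilityMeasure P]
  {U : ℕ → Ω → ℝ}

theorem map_sum_range_succ (hind : iIndepFun U P)
    (hU : ∀ i, HasLaw (U i) (volume.restrict (Set.Icc (0 : ℝ) 1)) P) (n : ℕ) :
    P.map (fun ω => ∑ i ∈ Finset.range (n + 1), U i ω)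
      = (volume.restrict (Set.Icc (0 : ℝ) 1)).conv
          (P.map (fun ω => ∑ i ∈ Finset.range n, U i ω)) := by
  have hm (i : ℕ) : AEMeasurable (U i) P := (hU i).aemeasurable
  have h := (hind.indepFun_finsetSum_of_notMem₀ hm (Finset.notMem_range_self (n := n))).symm
  have h2 := h.map_add_eq_map_conv_map₀ (hm n) (Finset.aemeasurable_sum _ fun i _ => hm i)
  rw [(hU n).map_eq] at h2
  have h3 (m : ℕ) : (fun ω => ∑ i ∈ Finset.range m, U i ω) = ∑ i ∈ Finset.range m, U i := by
    funext ω; simp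
  rw [h3, h3, Finset.sum_range_succ, add_comm, h2]

/-- The distribution function of a sum of independent uniform random variables. -/
theorem map_sum_range_real_Iic (hind : iIndepFun U P)
    (hU : ∀ i, HasLaw (U i) (volume.restrict (Set.Icc (0 : ℝ) 1)) P) (n : ℕ) (x : ℝ) :
    (P.map (fun ω => ∑ i ∈ Finset.range n, U i ω)).real (Set.Iic x)
      = backwardDiff^[n] (truncPow n) x := by
  induction n generalizing x with
  | zero =>
    by_cases hx : 0 ≤ x <;>
      simp [truncPow, hx, measureReal_def, Measure.map_const]
  | succ n ih =>
    have : IsProbabilityMeasure (P.map (fun ω => ∑ i ∈ Finset.range n, U i ω)) :=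
      Measure.isProbabilityMeasure_map
        (Finset.aemeasurable_fun_sum _ fun i _ => (hU i).aemeasurable)
    rw [map_sum_range_succ hind hU, measureReal_uniform_conv_Iic, ← integral_backwardDiff_truncPow]
    exact intervalIntegral.integral_congr fun u _ => ih _

theorem map_sum_range_real_Ico (hind : iIndepFun U P)
    (hU : ∀ i, HasLaw (U i) (volume.restrict (Set.Icc (0 : ℝ) 1)) P) {n : ℕ} (hn : n ≠ 0) (x : ℝ) :
    (P.map (fun ω => ∑ i ∈ Finset.range n, U i ω)).real (Set.Ico (x - 1) x)
      = backwardDiff^[n + 1] (truncPow n) x := by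
  have : IsProbabilityMeasure (P.map (fun ω => ∑ i ∈ Finset.range n, U i ω)) :=
    Measure.isProbabilityMeasure_map
      (Finset.aemeasurable_fun_sum _ fun i _ => (hU i).aemeasurable)
  -- Rounding cells are closed on the left, differences of distribution functions on the right;
  -- absence of atoms reconciles them. This fails for the empty sum, whence `n ≠ 0`.
  have hac : P.map (fun ω => ∑ i ∈ Finset.range n, U i ω) ≪ volume := by
    obtain ⟨m, rfl⟩ := Nat.exists_eq_succ_of_ne_zero hn
    have : IsProbabilityMeasure (P.map (fun ω => ∑ i ∈ Finset.range m, U i ω)) :=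
      Measure.isProbabilityMeasure_map
        (Finset.aemeasurable_fun_sum _ fun i _ => (hU i).aemeasurable)
    rw [Nat.succ_eq_add_one, map_sum_range_succ hind hU, Measure.conv_comm]
    exact Measure.conv_absolutelyContinuous Measure.restrict_le_self.absolutelyContinuous
  have hIoc : Set.Ioc (x - 1) x = Set.Iic x \ Set.Iic (x - 1) := by
    ext y; simp [and_comm]
  rw [measureReal_congr (hac.ae_eq Ico_ae_eq_Ioc), hIoc,
    measureReal_sdiff (Set.Iic_subset_Iic.2 (by linarith)) measurableSet_Iic,
    map_sum_range_real_Iic hind hU, map_sum_range_real_Iic hind hU, backwardDiff_iterate_succ]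

/-! ### The law of the rounded sum -/

theorem measurable_rhoRound (ρ : ℝ) : Measurable (rhoRound ρ) := by
  unfold rhoRound
  fun_prop

theorem rhoRound_eq_fract_sub_floor (ρ x : ℝ) :
    rhoRound ρ x = rhoRound (Int.fract ρ) x - ⌊ρ⌋ := by
  rw [rhoRound, rhoRound, ← Int.floor_sub_intCast, ← Int.self_sub_floor]
  congr 1
  ring

theorem rhoRound_preimage_singleton (ρ : ℝ) (k : ℤ) :
    rhoRound ρ ⁻¹' {k} = Set.Ico ((k : ℝ) + ρ - 1) (k + ρ) := by
  ext x
  simp only [rhoRound, Set.mem_preimage, Set.mem_singleton_iff, Int.floor_eq_iff, Set.mem_Ico]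
  constructor <;> rintro ⟨h1, h2⟩ <;> constructor <;> linarith

theorem unitDist_singleton_natCast (n k : ℕ) (ρ : ℝ) :
    unitDist n ρ {(k : ℤ)} = ENNReal.ofReal (number n k ρ / n !) := by
  simp only [unitDist, Measure.coe_finsetSum, Finset.sum_apply, Measure.smul_apply, smul_eq_mul,
    Measure.dirac_apply, Set.indicator, Set.mem_singleton_iff, Nat.cast_inj, Pi.one_apply, mul_ite,
    mul_one, mul_zero, Finset.sum_ite_eq', Finset.mem_range]
  split_ifs with h
  · rfl
  · rw [number_eq_zero ρ (by omega)]; simp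

theorem unitDist_singleton_of_neg (n : ℕ) (ρ : ℝ) {k : ℤ} (hk : k < 0) :
    unitDist n ρ {k} = 0 := by
  simp only [unitDist, Measure.coe_finsetSum, Finset.sum_apply, Measure.smul_apply, smul_eq_mul,
    Measure.dirac_apply, Set.indicator, Set.mem_singleton_iff]
  refine Finset.sum_eq_zero fun i _ => ?_
  rw [if_neg (by omega), mul_zero]

theorem map_rhoRound_eq_unitDist {ρ : ℝ} (h0 : 0 ≤ ρ) (h1 : ρ < 1) (hind : iIndepFun U P)
    (hU : ∀ i, HasLaw (U i) (volume.restrict (Set.Icc (0 : ℝ) 1)) P) {n : ℕ} (hn : n ≠ 0) :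
    (P.map (fun ω => ∑ i ∈ Finset.range n, U i ω)).map (rhoRound ρ) = unitDist n ρ := by
  have : IsProbabilityMeasure (P.map (fun ω => ∑ i ∈ Finset.range n, U i ω)) :=
    Measure.isProbabilityMeasure_map
      (Finset.aemeasurable_fun_sum _ fun i _ => (hU i).aemeasurable)
  refine Measure.ext_of_singleton fun k => ?_
  rw [Measure.map_apply (measurable_rhoRound ρ) (measurableSet_singleton k),
    rhoRound_preimage_singleton, ← ofReal_measureReal, map_sum_range_real_Ico hind hU hn]
  rcases lt_or_ge k 0 with hk | hk
  · have hk' : (k : ℝ) ≤ -1 := by exact_mod_cast Int.le_sub_one_of_lt hk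
    rw [unitDist_singleton_of_neg n ρ hk,
      backwardDiff_iterate_truncPow_of_neg _ _ (by linarith), ENNReal.ofReal_zero]
  · lift k to ℕ using hk
    rw [unitDist_singleton_natCast, number_eq_factorial_mul_backwardDiff h0 h1,
      mul_div_cancel_left₀ _ (by positivity), Int.cast_natCast]

/-- For `n ≥ 1`, the `ρ`-rounding of a sum of `n` independent uniform random variables has the
Euler--Frobenius distribution. -/
theorem hasLaw_rhoRound_sum (ρ : ℝ) (hind : iIndepFun U P)
    (hU : ∀ i, HasLaw (U i) (volume.restrict (Set.Icc (0 : ℝ) 1)) P) {n : ℕ} (hn : n ≠ 0) :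
    HasLaw (fun ω => rhoRound ρ (∑ i ∈ Finset.range n, U i ω)) (EulerFrobenius.dist n ρ) P := by
  have hS : AEMeasurable (fun ω => ∑ i ∈ Finset.range n, U i ω) P :=
    Finset.aemeasurable_fun_sum _ fun i _ => (hU i).aemeasurable
  refine ⟨(measurable_rhoRound ρ).comp_aemeasurable hS, ?_⟩
  rw [EulerFrobenius.dist,
    ← map_rhoRound_eq_unitDist (Int.fract_nonneg ρ) (Int.fract_lt_one ρ) hind hU hn,
    Measure.map_map (by fun_prop) (measurable_rhoRound _),
    AEMeasurable.map_map_of_aemeasurable (Measurable.aemeasurable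
      (Measurable.comp (by fun_prop) (measurable_rhoRound _))) hS]
  congr 1
  funext ω
  exact rhoRound_eq_fract_sub_floor ρ _

/-! ### Convergence in distribution and bounded perturbations -/

open scoped Topology NNReal

/-- Convergence in distribution depends only on the laws, and for the sequence only eventually. -/
theorem tendstoInDistribution_of_eventually_map_eq {ι E Ωl Ωl' : Type*} {Ω Ω' : ι → Type*}
    [MeasurableSpace Ωl] [MeasurableSpace Ωl'] {mΩ : ∀ i, MeasurableSpace (Ω i)}
    {mΩ' : ∀ i, MeasurableSpace (Ω' i)} [TopologicalSpace E] [MeasurableSpace E]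
    [OpensMeasurableSpace E] {l : Filter ι}
    {μ : ∀ i, Measure (Ω i)} [∀ i, IsProbabilityMeasure (μ i)]
    {μ' : ∀ i, Measure (Ω' i)} [∀ i, IsProbabilityMeasure (μ' i)]
    {ν : Measure Ωl} [IsProbabilityMeasure ν] {ν' : Measure Ωl'} [IsProbabilityMeasure ν']
    {X : ∀ i, Ω i → E} {Y : ∀ i, Ω' i → E} {Z : Ωl → E} {W : Ωl' → E}
    (h : TendstoInDistribution X l Z μ ν) (hY : ∀ i, AEMeasurable (Y i) (μ' i))
    (hW : AEMeasurable W ν') (hXY : ∀ᶠ i in l, (μ i).map (X i) = (μ' i).map (Y i))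
    (hZW : ν.map Z = ν'.map W) :
    TendstoInDistribution Y l W μ' ν' where
  forall_aemeasurable := hY
  aemeasurable_limit := hW
  tendsto := by
    have hlim : (⟨ν'.map W, Measure.isProbabilityMeasure_map hW⟩ : ProbabilityMeasure E)
        = ⟨ν.map Z, Measure.isProbabilityMeasure_map h.aemeasurable_limit⟩ :=
      Subtype.ext hZW.symm
    rw [hlim]
    exact h.tendsto.congr' (hXY.mono fun i hi => Subtype.ext hi)

theorem tendstoInMeasure_of_forall_tendsto_uniform {Ω : Type*} [MeasurableSpace Ω] {P : Measure Ω}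
    [IsProbabilityMeasure P] {Y : ℕ → Ω → ℝ} (hY : ∀ n, AEMeasurable (Y n) P) {b : ℕ → ℝ}
    (hb : Tendsto b atTop (𝓝 0)) (hYb : ∀ n ω, |Y n ω| ≤ b n) :
    TendstoInMeasure P Y atTop (fun _ => (0 : ℝ)) :=
  tendstoInMeasure_of_tendsto_ae (fun n => (hY n).aestronglyMeasurable)
    (ae_of_all _ fun ω => squeeze_zero_norm (fun n => hYb n ω) hb)

theorem tendsto_const_div_sqrt_natCast (c : ℝ) :
    Tendsto (fun n : ℕ => c / √(n : ℝ)) atTop (𝓝 0) :=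
  tendsto_const_nhds.div_atTop (Real.tendsto_sqrt_atTop.comp tendsto_natCast_atTop_atTop)

section Variance

variable {Ω : Type*} [MeasurableSpace Ω] {P : Measure Ω} [IsProbabilityMeasure P]

theorem variance_add_mul {S D : Ω → ℝ} (hS : MemLp S 2 P) (hD : MemLp D 2 P) (t : ℝ) :
    Var[fun ω => S ω + t * D ω; P] = Var[S; P] + t ^ 2 * Var[D; P] + 2 * (t * cov[S, D; P]) := by
  rw [variance_fun_add hS (hD.const_mul t), variance_const_mul, covariance_const_mul_right]
  ring

/-- A uniformly bounded perturbation does not change the asymptotics of a linearly growing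
variance. -/
theorem tendsto_variance_add_div {S D : ℕ → Ω → ℝ} (hS : ∀ n, MemLp (S n) 2 P)
    (hD : ∀ n, AEMeasurable (D n) P) {v C : ℝ} (hv : ∀ n : ℕ, Var[S n; P] = n * v)
    (hDC : ∀ n ω, |D n ω| ≤ C) :
    Tendsto (fun n : ℕ => Var[fun ω => S n ω + D n ω; P] / n) atTop (𝓝 v) := by
  have hD2 (n : ℕ) : MemLp (D n) 2 P :=
    .of_bound (hD n).aestronglyMeasurable C (ae_of_all _ fun ω => hDC n ω)
  have hVD (n : ℕ) : Var[D n; P] ≤ C ^ 2 := by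
    have := variance_le_sq_of_bounded (ae_of_all P fun ω => abs_le.1 (hDC n ω)) (hD n)
    rwa [show (C - -C) / 2 = C by ring] at this
  have hlim : Tendsto (fun n : ℕ => C ^ 2 / (n : ℝ) + (v + C ^ 2) / √(n : ℝ)) atTop (𝓝 0) := by
    simpa using (tendsto_const_div_atTop_nhds_zero_nat (C ^ 2)).add
      (tendsto_const_div_sqrt_natCast (v + C ^ 2))
  rw [← tendsto_sub_nhds_zero_iff]
  refine squeeze_zero_norm' ?_ hlim
  filter_upwards [eventually_gt_atTop 0] with n hn
  have hn' : (0 : ℝ) < n := by exact_mod_cast hn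
  have hs : 0 < √(n : ℝ) := Real.sqrt_pos.2 hn'
  have hss : √(n : ℝ) ^ 2 = n := Real.sq_sqrt hn'.le
  have hsum := variance_add_mul (hS n) (hD2 n) 1
  -- Nonnegativity of the variance of `S ± √n D` bounds the covariance; the weight `√n` makes both
  -- variance terms of order `n`, so `cov[S, D] = O(√n)`.
  have hp := variance_add_mul (hS n) (hD2 n) (√n)
  have hm := variance_add_mul (hS n) (hD2 n) (-√n)
  have hp0 := variance_nonneg (fun ω => S n ω + √n * D n ω) P
  have hm0 := variance_nonneg (fun ω => S n ω + -√n * D n ω) P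
  have hV0 := variance_nonneg (D n) P
  have hV1 := hVD n
  rw [hp, hv, hss] at hp0
  rw [hm, hv, neg_sq, hss] at hm0
  simp only [one_mul, one_pow, hv] at hsum
  have hcov : |2 * cov[S n, D n; P]| ≤ √n * (v + C ^ 2) := by
    have hmul : (n : ℝ) * Var[D n; P] ≤ n * C ^ 2 := by gcongr
    rw [abs_le]
    constructor
    · refine le_of_mul_le_mul_left ?_ hs
      linear_combination hp0 + hmul - (v + C ^ 2) * hss
    · refine le_of_mul_le_mul_left ?_ hs
      linear_combination hm0 + hmul - (v + C ^ 2) * hss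
  rw [hsum, Real.norm_eq_abs,
    show ((n : ℝ) * v + Var[D n; P] + 2 * cov[S n, D n; P]) / n - v
      = Var[D n; P] / n + 2 * cov[S n, D n; P] / n by field_simp; ring]
  refine (abs_add_le _ _).trans (add_le_add ?_ ?_)
  · rw [abs_of_nonneg (by positivity)]
    gcongr
  · rw [abs_div, abs_of_pos hn', div_le_div_iff₀ hn' hs]
    calc |2 * cov[S n, D n; P]| * √n ≤ √n * (v + C ^ 2) * √n := by gcongr
      _ = (v + C ^ 2) * n := by linear_combination (v + C ^ 2) * hss

end Variance

/-! ### Moments of the uniform distribution -/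

section Uniform

variable {Ω : Type*} [MeasurableSpace Ω] {P : Measure Ω} {V : Ω → ℝ}

theorem integral_of_hasLaw_uniform (hV : HasLaw V (volume.restrict (Set.Icc (0 : ℝ) 1)) P) :
    ∫ ω, V ω ∂P = 1 / 2 := by
  rw [hV.integral_eq, integral_Icc_eq_integral_Ioc, ← intervalIntegral.integral_of_le zero_le_one]
  simp

theorem variance_of_hasLaw_uniform (hV : HasLaw V (volume.restrict (Set.Icc (0 : ℝ) 1)) P) :
    Var[V; P] = 1 / 12 := by
  have h12 := integral_of_hasLaw_uniform (P := volume.restrict (Set.Icc (0 : ℝ) 1)) HasLaw.id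
  rw [hV.variance_eq, variance_eq_integral aemeasurable_id, h12, integral_Icc_eq_integral_Ioc,
    ← intervalIntegral.integral_of_le zero_le_one]
  simp only [id]
  rw [intervalIntegral.integral_comp_sub_right (fun x : ℝ => x ^ 2), integral_pow]
  norm_num

/-- Outside `L²` the variance takes the default value `0`, but here it is `1 / 12`. -/
theorem memLp_of_hasLaw_uniform (hV : HasLaw V (volume.restrict (Set.Icc (0 : ℝ) 1)) P) :
    MemLp V 2 P := by
  by_contra h
  have : IsFiniteMeasure P := hV.isFiniteMeasure
  have h2 := variance_of_not_memLp hV.aemeasurable.aestronglyMeasurable h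
  rw [variance_of_hasLaw_uniform hV] at h2
  norm_num at h2

theorem hasLaw_of_isUniform (hV : pdf.IsUniform V (Set.Icc (0 : ℝ) 1) P volume) :
    HasLaw V (volume.restrict (Set.Icc (0 : ℝ) 1)) P :=
  ⟨hV.aemeasurable (by simp) (by simp), by
    rw [pdf.IsUniform] at hV
    simp [hV, ProbabilityTheory.cond]⟩

end Uniform

/-! ### Central limit theorem for the rounded sum -/

section CLT

variable {Ω : Type*} [MeasurableSpace Ω] {P : Measure Ω} {U : ℕ → Ω → ℝ}

theorem memLp_sum_range (hU : ∀ i, HasLaw (U i) (volume.restrict (Set.Icc (0 : ℝ) 1)) P) (n : ℕ) :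
    MemLp (fun ω => ∑ i ∈ Finset.range n, U i ω) 2 P :=
  memLp_finsetSum _ fun i _ => memLp_of_hasLaw_uniform (hU i)

theorem variance_sum_range (hind : iIndepFun U P)
    (hU : ∀ i, HasLaw (U i) (volume.restrict (Set.Icc (0 : ℝ) 1)) P) (n : ℕ) :
    Var[fun ω => ∑ i ∈ Finset.range n, U i ω; P] = n * (1 / 12) := by
  have h := IndepFun.variance_sum (s := Finset.range n)
    (fun i _ => memLp_of_hasLaw_uniform (hU i)) (fun i _ j _ hij => hind.indepFun hij)
  have h3 : (fun ω => ∑ i ∈ Finset.range n, U i ω) = ∑ i ∈ Finset.range n, U i := by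
    funext ω; simp
  rw [h3, h]
  simp [fun i => variance_of_hasLaw_uniform (hU i)]

theorem aemeasurable_rhoRound_sum (ρ : ℝ)
    (hU : ∀ i, HasLaw (U i) (volume.restrict (Set.Icc (0 : ℝ) 1)) P) (n : ℕ) :
    AEMeasurable (fun ω => rhoRound ρ (∑ i ∈ Finset.range n, U i ω)) P :=
  (measurable_rhoRound ρ).comp_aemeasurable
    (Finset.aemeasurable_fun_sum _ fun i _ => (hU i).aemeasurable)

theorem aemeasurable_rhoRound_sum_cast (ρ : ℝ)
    (hU : ∀ i, HasLaw (U i) (volume.restrict (Set.Icc (0 : ℝ) 1)) P) (n : ℕ) :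
    AEMeasurable (fun ω => (rhoRound ρ (∑ i ∈ Finset.range n, U i ω) : ℝ)) P :=
  measurable_from_top.comp_aemeasurable (aemeasurable_rhoRound_sum ρ hU n)

theorem aemeasurable_rhoRound_sum_sub (ρ : ℝ)
    (hU : ∀ i, HasLaw (U i) (volume.restrict (Set.Icc (0 : ℝ) 1)) P) (n : ℕ) :
    AEMeasurable (fun ω => (rhoRound ρ (∑ i ∈ Finset.range n, U i ω) : ℝ)
      - ∑ i ∈ Finset.range n, U i ω) P :=
  (aemeasurable_rhoRound_sum_cast ρ hU n).sub
    (Finset.aemeasurable_fun_sum _ fun i _ => (hU i).aemeasurable)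

variable [IsProbabilityMeasure P]

theorem integral_sum_range (hU : ∀ i, HasLaw (U i) (volume.restrict (Set.Icc (0 : ℝ) 1)) P)
    (n : ℕ) : ∫ ω, ∑ i ∈ Finset.range n, U i ω ∂P = n / 2 := by
  rw [integral_finsetSum _ fun i _ => (memLp_of_hasLaw_uniform (hU i)).integrable one_le_two]
  simp [fun i => integral_of_hasLaw_uniform (hU i), div_eq_mul_inv]

theorem tendstoInDistribution_sum_uniform (hind : iIndepFun U P)
    (hU : ∀ i, HasLaw (U i) (volume.restrict (Set.Icc (0 : ℝ) 1)) P) :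
    TendstoInDistribution
      (fun (n : ℕ) ω => (√(n : ℝ))⁻¹ * (∑ i ∈ Finset.range n, U i ω - n * (1 / 2)))
      atTop (id : ℝ → ℝ) (fun _ => P) (gaussianReal 0 (1 / 12)) := by
  have hv : Var[U 0; P].toNNReal = 1 / 12 := by
    rw [variance_of_hasLaw_uniform (hU 0)]
    ext
    simp
  have h := tendstoInDistribution_inv_sqrt_mul_sum_sub (X := U) (P := P)
    (Y := (id : ℝ → ℝ)) (P' := gaussianReal 0 (1 / 12)) (hv ▸ HasLaw.id)
    (memLp_of_hasLaw_uniform (hU 0)) hind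
    (fun i => ⟨(hU i).aemeasurable, (hU 0).aemeasurable, by rw [(hU i).map_eq, (hU 0).map_eq]⟩)
  simpa only [integral_of_hasLaw_uniform (hU 0)] using h

theorem abs_rhoRound_sub_le (ρ x : ℝ) : |(rhoRound ρ x : ℝ) - x| ≤ |ρ| + 1 := by
  have h1 := Int.floor_le (x + 1 - ρ)
  have h2 := Int.lt_floor_add_one (x + 1 - ρ)
  have h3 := neg_abs_le ρ
  have h4 := le_abs_self ρ
  rw [rhoRound, abs_le]
  constructor <;> linarith

theorem tendstoInDistribution_rhoRound_sum (ρ : ℝ) (hind : iIndepFun U P)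
    (hU : ∀ i, HasLaw (U i) (volume.restrict (Set.Icc (0 : ℝ) 1)) P) :
    TendstoInDistribution
      (fun (n : ℕ) ω => ((rhoRound ρ (∑ i ∈ Finset.range n, U i ω) : ℝ) - (n : ℝ) / 2) / √(n : ℝ))
      atTop (id : ℝ → ℝ) (fun _ => P) (gaussianReal 0 (1 / 12)) := by
  have hYm (n : ℕ) := (aemeasurable_rhoRound_sum_sub ρ hU n).div_const √(n : ℝ)
  have hY := tendstoInMeasure_of_forall_tendsto_uniform hYm
    (tendsto_const_div_sqrt_natCast (|ρ| + 1)) fun n ω => by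
      rw [abs_div, abs_of_nonneg (Real.sqrt_nonneg _)]
      gcongr
      exact abs_rhoRound_sub_le _ _
  refine ((tendstoInDistribution_sum_uniform hind hU).add_of_tendstoInMeasure_const hY hYm).congr
    (fun n => ae_of_all _ fun ω => ?_) (ae_of_all _ fun x => by simp)
  simp only [Pi.add_apply]
  ring

theorem tendsto_variance_rhoRound_sum_div (ρ : ℝ) (hind : iIndepFun U P)
    (hU : ∀ i, HasLaw (U i) (volume.restrict (Set.Icc (0 : ℝ) 1)) P) :
    Tendsto (fun n : ℕ => Var[fun ω => (rhoRound ρ (∑ i ∈ Finset.range n, U i ω) : ℝ); P] / n)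
      atTop (𝓝 (1 / 12)) := by
  simpa only [add_sub_cancel] using tendsto_variance_add_div (memLp_sum_range hU)
    (aemeasurable_rhoRound_sum_sub ρ hU) (variance_sum_range hind hU)
    (fun n ω => abs_rhoRound_sub_le ρ _)

theorem abs_integral_rhoRound_sum_sub_le (ρ : ℝ)
    (hU : ∀ i, HasLaw (U i) (volume.restrict (Set.Icc (0 : ℝ) 1)) P) (n : ℕ) :
    |(n : ℝ) / 2 - ∫ ω, (rhoRound ρ (∑ i ∈ Finset.range n, U i ω) : ℝ) ∂P| ≤ |ρ| + 1 := by
  have hS := (memLp_sum_range hU n).integrable one_le_two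
  have hD : Integrable (fun ω => (rhoRound ρ (∑ i ∈ Finset.range n, U i ω) : ℝ)
      - ∑ i ∈ Finset.range n, U i ω) P :=
    .of_bound (aemeasurable_rhoRound_sum_sub ρ hU n).aestronglyMeasurable (|ρ| + 1)
      (ae_of_all _ fun ω => abs_rhoRound_sub_le ρ _)
  have h := integral_add hS hD
  simp only [add_sub_cancel] at h
  rw [h, integral_sum_range hU, sub_add_cancel_left, abs_neg]
  have hb : ∀ᵐ ω ∂P, ‖(rhoRound ρ (∑ i ∈ Finset.range n, U i ω) : ℝ)
      - ∑ i ∈ Finset.range n, U i ω‖ ≤ |ρ| + 1 := ae_of_all P fun ω => abs_rhoRound_sub_le ρ _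
  simpa using norm_integral_le_of_norm_le_const hb

theorem tendstoInDistribution_standardized_rhoRound_sum (ρ : ℝ) (hind : iIndepFun U P)
    (hU : ∀ i, HasLaw (U i) (volume.restrict (Set.Icc (0 : ℝ) 1)) P) :
    TendstoInDistribution
      (fun (n : ℕ) ω => ((rhoRound ρ (∑ i ∈ Finset.range n, U i ω) : ℝ)
          - ∫ ω', (rhoRound ρ (∑ i ∈ Finset.range n, U i ω') : ℝ) ∂P)
        / √(Var[fun ω' => (rhoRound ρ (∑ i ∈ Finset.range n, U i ω') : ℝ); P]))
      atTop (id : ℝ → ℝ) (fun _ => P) (gaussianReal 0 1) := by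
  set m : ℕ → ℝ := fun n => ∫ ω', (rhoRound ρ (∑ i ∈ Finset.range n, U i ω') : ℝ) ∂P with hm
  set w : ℕ → ℝ := fun n => Var[fun ω' => (rhoRound ρ (∑ i ∈ Finset.range n, U i ω') : ℝ); P]
    with hw
  have hc : Tendsto (fun n : ℕ => ((n : ℝ) / 2 - m n) / √(n : ℝ)) atTop (𝓝 0) :=
    squeeze_zero_norm (fun n => by
      rw [Real.norm_eq_abs, abs_div, abs_of_nonneg (Real.sqrt_nonneg _)]
      exact div_le_div_of_nonneg_right (abs_integral_rhoRound_sum_sub_le ρ hU n)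
        (Real.sqrt_nonneg _)) (tendsto_const_div_sqrt_natCast (|ρ| + 1))
  have hr : Tendsto (fun n : ℕ => (√(w n / n))⁻¹) atTop (𝓝 (√(1 / 12))⁻¹) :=
    (tendsto_variance_rhoRound_sum_div ρ hind hU).sqrt.inv₀ (by positivity)
  have hcr : TendstoInMeasure P
      (fun (n : ℕ) (_ : Ω) => (((n : ℝ) / 2 - m n) / √(n : ℝ), (√(w n / n))⁻¹)) atTop
      (fun _ => ((0 : ℝ), (√(1 / 12 : ℝ))⁻¹)) :=
    tendstoInMeasure_of_tendsto_ae (fun n => aestronglyMeasurable_const)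
      (ae_of_all _ fun _ => hc.prodMk_nhds hr)
  -- With mean `m n` and variance `w n`, the standardised variable is `(Y + c) * r`, where `Y = (Z -
  -- n / 2) / √n`, `c = (n / 2 - m n) / √n → 0` and `r = √(n / w n) → √12`. Slutsky applies to the
  -- pair `(c, r)`.
  have h := (tendstoInDistribution_rhoRound_sum ρ hind
    hU).continuous_comp_prodMk_of_tendstoInMeasure_const
    (g := fun p : ℝ × ℝ × ℝ => (p.1 + p.2.1) * p.2.2) (by fun_prop) hcr
    (fun n => aemeasurable_const)
  refine tendstoInDistribution_of_eventually_map_eq h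
    (fun n => ((aemeasurable_rhoRound_sum_cast ρ hU n).sub_const _).div_const _)
    aemeasurable_id ?_ ?_
  · filter_upwards [eventually_gt_atTop 0] with n hn
    have hn' : (0 : ℝ) < √(n : ℝ) := Real.sqrt_pos.2 (by exact_mod_cast hn)
    congr 1
    funext ω
    rw [Real.sqrt_div' _ (Nat.cast_nonneg n), inv_div]
    field_simp
    ring
  · simp only [id, add_zero]
    -- Scaling by `√12` turns variance `1 / 12` into `1`.
    rw [gaussianReal_map_mul_const, Measure.map_id]
    congr 1
    · simp
    · ext
      simp

end CLT

theorem exists_iIndepFun_uniform :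
    ∃ (Ω : Type) (_ : MeasurableSpace Ω) (P : Measure Ω) (U : ℕ → Ω → ℝ), IsProbabilityMeasure P ∧
      iIndepFun U P ∧ ∀ i, HasLaw (U i) (volume.restrict (Set.Icc (0 : ℝ) 1)) P := by
  have : IsProbabilityMeasure (volume.restrict (Set.Icc (0 : ℝ) 1)) := ⟨by simp⟩
  obtain ⟨Ω, mΩ, P, U, -, hU, hind, hP⟩ := exists_iid ℕ (volume.restrict (Set.Icc (0 : ℝ) 1))
  exact ⟨Ω, mΩ, P, U, hP, hind, hU⟩

end EulerFrobenius

theorem mainTheorem8 (ρ : ℝ) :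
    (∀ (Ω : ℕ → Type*) [∀ n, MeasurableSpace (Ω n)]
      (P : ∀ n, Measure (Ω n)) [∀ n, IsProbabilityMeasure (P n)]
      (X : ∀ n, Ω n → ℤ), (∀ n, HasLaw (X n) (EulerFrobenius.dist n ρ) (P n)) →
        TendstoInDistribution
          (fun (n : ℕ) (ω : Ω n) =>
            ((X n ω : ℝ) - ∫ ω', (X n ω' : ℝ) ∂(P n)) / √(Var[fun ω' => (X n ω' : ℝ); P n]))
          atTop (id : ℝ → ℝ) P (gaussianReal 0 1) ∧
        TendstoInDistribution
          (fun (n : ℕ) (ω : Ω n) => ((X n ω : ℝ) - (n : ℝ) / 2) / √(n : ℝ))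
          atTop (id : ℝ → ℝ) P (gaussianReal 0 (1 / 12))) ∧
    (∀ (Ω : Type*) [MeasurableSpace Ω] (P : Measure Ω) [IsProbabilityMeasure P]
      (U : ℕ → Ω → ℝ), iIndepFun U P →
      (∀ i, pdf.IsUniform (U i) (Set.Icc (0 : ℝ) 1) P volume) →
      ∀ Z : ℕ → Ω → ℤ,
        (∀ n ω, Z n ω = EulerFrobenius.rhoRound ρ (∑ i ∈ Finset.range n, U i ω)) →
        TendstoInDistribution
          (fun (n : ℕ) (ω : Ω) =>
            ((Z n ω : ℝ) - ∫ ω', (Z n ω' : ℝ) ∂P) / √(Var[fun ω' => (Z n ω' : ℝ); P]))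
          atTop (id : ℝ → ℝ) (fun _ => P) (gaussianReal 0 1) ∧
        TendstoInDistribution
          (fun (n : ℕ) (ω : Ω) => ((Z n ω : ℝ) - (n : ℝ) / 2) / √(n : ℝ))
          atTop (id : ℝ → ℝ) (fun _ => P) (gaussianReal 0 (1 / 12))) := by
  constructor
  · intro Ω _ P _ X hX
    -- The `X n` may live on unrelated spaces. Only their laws matter, means and variances included,
    -- so the limits transfer from an auxiliary uniform model, with `n = 0` discarded.
    obtain ⟨Ω', _, Q, U, _, hind, hU⟩ := EulerFrobenius.exists_iIndepFun_uniform
    have hcast : Measurable (Int.cast : ℤ → ℝ) := measurable_from_top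
    have hXm (n : ℕ) : AEMeasurable (fun ω => (X n ω : ℝ)) (P n) :=
      hcast.comp_aemeasurable (hX n).aemeasurable
    have hid {n : ℕ} (hn : 0 < n) :
        IdentDistrib (fun ω => (EulerFrobenius.rhoRound ρ (∑ i ∈ Finset.range n, U i ω) : ℝ))
          (fun ω => (X n ω : ℝ)) Q (P n) := by
      have hZ := EulerFrobenius.hasLaw_rhoRound_sum ρ hind hU hn.ne'
      exact IdentDistrib.comp ⟨hZ.aemeasurable, (hX n).aemeasurable,
        hZ.map_eq.trans (hX n).map_eq.symm⟩ hcast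
    constructor
    · refine EulerFrobenius.tendstoInDistribution_of_eventually_map_eq
        (EulerFrobenius.tendstoInDistribution_standardized_rhoRound_sum ρ hind hU)
        (fun n => ((hXm n).sub_const _).div_const _) aemeasurable_id ?_ rfl
      filter_upwards [eventually_gt_atTop 0] with n hn
      rw [(hid hn).integral_eq, (hid hn).variance_eq]
      exact (((hid hn).sub_const _).div_const _).map_eq
    · refine EulerFrobenius.tendstoInDistribution_of_eventually_map_eq
        (EulerFrobenius.tendstoInDistribution_rhoRound_sum ρ hind hU)
        (fun n => ((hXm n).sub_const _).div_const _) aemeasurable_id ?_ rfl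
      filter_upwards [eventually_gt_atTop 0] with n hn
      exact (((hid hn).sub_const _).div_const _).map_eq
  · intro Ω _ P _ U hind hU Z hZ
    obtain rfl : Z = fun n ω => EulerFrobenius.rhoRound ρ (∑ i ∈ Finset.range n, U i ω) := by
      funext n ω; exact hZ n ω
    have hU' (i : ℕ) := EulerFrobenius.hasLaw_of_isUniform (hU i)
    exact ⟨EulerFrobenius.tendstoInDistribution_standardized_rhoRound_sum ρ hind hU',
      EulerFrobenius.tendstoInDistribution_rhoRound_sum ρ hind hU'⟩
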